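/- Let $\mathcal{A}$ be a Krull–Schmidt additive category (every object is a finite direct sum of objects with local endomorphism rings) and let $(\mathcal{A},\mathbb{E},\mathfrak{s})$ be an extriangulated category in the sense of Nakaoka and Palu: $\mathbb{E}\colon\mathcal{A}^{\mathrm{op}}\times\mathcal{A}\to\mathrm{Ab}$ is an additive bifunctor and $\mathfrak{s}$ is an additive realization, assigning to each $\delta\in\mathbb{E}(M,X)$ an equivalence class $\mathfrak{s}(\delta)=[X\to L\to M]$, such that the axioms (ET1)–(ET4), (ET3)$^{\mathrm{op}}$, (ET4)$^{\mathrm{op}}$ hold. If $\mathfrak{s}(\delta)=[X\xrightarrow{x}L\xrightarrow{y}M]$, then $X\xrightarrow{x}L\xrightarrow{y}M\overset{\delta}{\dashrightarrow}$ is called an $\mathbb{E}$-triangle. A map $\Theta$ from the set of isomorphism classes of objects of $\mathcal{A}$ to $\mathbb{N}=\{0,1,2,\dots\}$ is a *length function* on $(\mathcal{A},\mathbb{E},\mathfrak{s})$ if $\Theta(X)=0$ exactly when $X\cong 0$, and for every $\mathbb{E}$-triangle $X\to L\to M\overset{\delta}{\dashrightarrow}$ one has $\Theta(L)\le\Theta(X)+\Theta(M)$,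 with equality if $\delta=0$. It is *stable* if $\Theta(L)=\Theta(X)+\Theta(M)$ for every $\mathbb{E}$-triangle. An $\mathbb{E}$-triangle $X\xrightarrow{x}L\xrightarrow{y}M\overset{\delta}{\dashrightarrow}$ with $\Theta(L)=\Theta(X)+\Theta(M)$ is called *$\Theta$-stable*; then $x$ is called a $\Theta$-inflation, $y$ a $\Theta$-deflation and $\delta$ a $\Theta$-extension. The pair $((\mathcal{A},\mathbb{E},\mathfrak{s}),\Theta)$ is a *length category* if $\Theta$ is a length function and every morphism $f$ of $\mathcal{A}$ factors as $f=j\circ i$ with $i$ a $\Theta$-deflation and $j$ a $\Theta$-inflation; it is a *stable length category* if moreover $\Theta$ is stable. Let $\mathbb{E}_\Theta(M,X)\subseteq\mathbb{E}(M,X)$ be the set of all $\Theta$-extensions, and let $\mathfrak{s}_\Theta$ be the restriction of $\mathfrak{s}$ to $\mathbb{E}_\Theta$. **Proposition.** If $((\mathcal{A},\mathbb{E},\mathfrak{s}),\Theta)$ is a length category, then $\mathbb{E}_\Theta$ is an additive subfunctor of $\mathbb{E}$ (each $\mathbb{E}_\Theta(M,X)$ is a subgroup of $\mathbb{E}(M,X)$,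 and these subgroups are preserved by the maps $\mathbb{E}(c,a)$), the triple $(\mathcal{A},\mathbb{E}_\Theta,\mathfrak{s}_\Theta)$ is an extriangulated category, and $((\mathcal{A},\mathbb{E}_\Theta,\mathfrak{s}_\Theta),\Theta)$ is a stable length category. -/

import Mathlib

open CategoryTheory CategoryTheory.Limits Opposite

universe w v u

attribute [local instance] hasBinaryBiproducts_of_finite_biproducts

noncomputable section

namespace Extri

variable {C : Type u} [Category.{v} C]

/-! ### Bifunctors to abelian groups -/

/-- The group `𝔼(Z, X)` of extensions, contravariant in `Z` and covariant in `X`. -/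
abbrev Ext (E : Cᵒᵖ ⥤ C ⥤ AddCommGrpCat.{w}) (Z X : C) : Type w :=
  (E.obj (op Z)).obj X

/-- `a_* δ = 𝔼(Z, a)(δ)`. -/
def push (E : Cᵒᵖ ⥤ C ⥤ AddCommGrpCat.{w}) {Z X X' : C} (a : X ⟶ X') (δ : Ext E Z X) :
    Ext E Z X' :=
  ((E.obj (op Z)).map a).hom δ

/-- `c^* δ = 𝔼(c, X)(δ)`. -/
def pull (E : Cᵒᵖ ⥤ C ⥤ AddCommGrpCat.{w}) {Z Z' X : C} (c : Z' ⟶ Z) (δ : Ext E Z X) :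
    Ext E Z' X :=
  ((E.map c.op).app X).hom δ

/-! ### Equivalence classes of sequences and realizations -/

/-- A sequence `X ⟶ Y ⟶ Z` with fixed ends `X` and `Z`. -/
structure Seq (X Z : C) where
  /-- the middle term -/
  mid : C
  /-- the first morphism -/
  i : X ⟶ mid
  /-- the second morphism -/
  p : mid ⟶ Z

/-- Two sequences with the same ends are equivalent if there is an isomorphism of the middle terms
that is compatible with the identities of the ends. -/
def Seq.Equiv {X Z : C} (S T : Seq X Z) : Prop :=
  ∃ h : S.mid ≅ T.mid, S.i ≫ h.hom = T.i ∧ h.hom ≫ T.p = S.p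

theorem Seq.equiv_equivalence (X Z : C) : Equivalence (Seq.Equiv (X := X) (Z := Z)) where
  refl S := ⟨Iso.refl _, by simp, by simp⟩
  symm := by
    rintro S T ⟨h, h₁, h₂⟩
    exact ⟨h.symm, by simp [← h₁], by simp [← h₂]⟩
  trans := by
    rintro S T U ⟨h, h₁, h₂⟩ ⟨k, k₁, k₂⟩
    exact ⟨h.trans k, by simp [← h₁, ← k₁], by simp [← h₂, ← k₂]⟩

instance Seq.setoid (X Z : C) : Setoid (Seq X Z) := ⟨Seq.Equiv, Seq.equiv_equivalence X Z⟩

/-- A correspondence `𝔰` that assigns to every `δ ∈ 𝔼(Z, X)` an equivalence class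
`[X ⟶ Y ⟶ Z]` of sequences. -/
abbrev Correspondence (E : Cᵒᵖ ⥤ C ⥤ AddCommGrpCat.{w}) :=
  ∀ ⦃Z X : C⦄, Ext E Z X → Quotient (Seq.setoid X Z)

/-- `X ⟶ Y ⟶ Z ⇢` (with morphisms `x`, `y` and extension `δ`) is an `𝔼`-triangle:
`𝔰(δ) = [X ⟶ Y ⟶ Z]`. -/
def IsTriangle {E : Cᵒᵖ ⥤ C ⥤ AddCommGrpCat.{w}} (s : Correspondence E) {X Y Z : C}
    (x : X ⟶ Y) (y : Y ⟶ Z) (δ : Ext E Z X) : Prop :=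
  s δ = Quotient.mk (Seq.setoid X Z) ⟨Y, x, y⟩

section Additive

variable [Preadditive C] [HasFiniteBiproducts C]

/-- The direct sum `δ ⊕ δ' ∈ 𝔼(Z ⊞ Z', X ⊞ X')` of two extensions, that is, the element with
components `(δ, 0, 0, δ')` under
`𝔼(Z ⊞ Z', X ⊞ X') ≅ 𝔼(Z, X) ⊕ 𝔼(Z, X') ⊕ 𝔼(Z', X) ⊕ 𝔼(Z', X')`. -/
def extSum (E : Cᵒᵖ ⥤ C ⥤ AddCommGrpCat.{w}) {Z X Z' X' : C} (δ : Ext E Z X)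
    (δ' : Ext E Z' X') : Ext E (Z ⊞ Z') (X ⊞ X') :=
  push E biprod.inl (pull E biprod.fst δ) + push E biprod.inr (pull E biprod.snd δ')

/-- `(C, 𝔼, 𝔰)` is an extriangulated category in the sense of Nakaoka and Palu. -/
structure IsExtriangulated (E : Cᵒᵖ ⥤ C ⥤ AddCommGrpCat.{w}) (s : Correspondence E) : Prop where
  /-- (ET1), covariant variable -/
  push_add : ∀ {Z X X' : C} (a b : X ⟶ X') (δ : Ext E Z X),
    push E (a + b) δ = push E a δ + push E b δ
  /-- (ET1), contravariant variable -/
  pull_add : ∀ {Z Z' X : C} (a b : Z' ⟶ Z) (δ : Ext E Z X),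
    pull E (a + b) δ = pull E a δ + pull E b δ
  /-- (ET2), `𝔰` is a realization -/
  realize : ∀ {X Y Z X' Y' Z' : C} {x : X ⟶ Y} {y : Y ⟶ Z} {δ : Ext E Z X}
    {x' : X' ⟶ Y'} {y' : Y' ⟶ Z'} {δ' : Ext E Z' X'},
    IsTriangle s x y δ → IsTriangle s x' y' δ' →
    ∀ (a : X ⟶ X') (c : Z ⟶ Z'), push E a δ = pull E c δ' →
      ∃ b : Y ⟶ Y', x ≫ b = a ≫ x' ∧ y ≫ c = b ≫ y'
  /-- (ET2), the zero extension is realized by the split sequence -/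
  realize_zero : ∀ X Z : C,
    IsTriangle s (biprod.inl : X ⟶ X ⊞ Z) (biprod.snd : X ⊞ Z ⟶ Z) (0 : Ext E Z X)
  /-- (ET2), `𝔰(δ ⊕ δ') = 𝔰(δ) ⊕ 𝔰(δ')` -/
  realize_sum : ∀ {X Y Z X' Y' Z' : C} {x : X ⟶ Y} {y : Y ⟶ Z} {δ : Ext E Z X}
    {x' : X' ⟶ Y'} {y' : Y' ⟶ Z'} {δ' : Ext E Z' X'},
    IsTriangle s x y δ → IsTriangle s x' y' δ' →
    IsTriangle s (biprod.map x x') (biprod.map y y') (extSum E δ δ')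
  /-- (ET3) -/
  et3 : ∀ {X Y Z X' Y' Z' : C} {x : X ⟶ Y} {y : Y ⟶ Z} {δ : Ext E Z X}
    {x' : X' ⟶ Y'} {y' : Y' ⟶ Z'} {δ' : Ext E Z' X'},
    IsTriangle s x y δ → IsTriangle s x' y' δ' →
    ∀ (a : X ⟶ X') (b : Y ⟶ Y'), x ≫ b = a ≫ x' →
      ∃ c : Z ⟶ Z', y ≫ c = b ≫ y' ∧ push E a δ = pull E c δ'
  /-- (ET3)ᵒᵖ -/
  et3_op : ∀ {X Y Z X' Y' Z' : C} {x : X ⟶ Y} {y : Y ⟶ Z} {δ : Ext E Z X}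
    {x' : X' ⟶ Y'} {y' : Y' ⟶ Z'} {δ' : Ext E Z' X'},
    IsTriangle s x y δ → IsTriangle s x' y' δ' →
    ∀ (b : Y ⟶ Y') (c : Z ⟶ Z'), y ≫ c = b ≫ y' →
      ∃ a : X ⟶ X', x ≫ b = a ≫ x' ∧ push E a δ = pull E c δ'
  /-- (ET4) -/
  et4 : ∀ {A B D K F : C} {f : A ⟶ B} {f' : B ⟶ D} {δ : Ext E D A}
    {g : B ⟶ K} {g' : K ⟶ F} {δ' : Ext E F B},
    IsTriangle s f f' δ → IsTriangle s g g' δ' →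
    ∃ (G : C) (h' : K ⟶ G) (d : D ⟶ G) (e : G ⟶ F) (δ'' : Ext E G A),
      f' ≫ d = g ≫ h' ∧ h' ≫ e = g' ∧
      IsTriangle s (f ≫ g) h' δ'' ∧
      IsTriangle s d e (push E f' δ') ∧
      pull E d δ'' = δ ∧
      push E f δ'' = pull E e δ'
  /-- (ET4)ᵒᵖ -/
  et4_op : ∀ {D A B F K : C} {f' : D ⟶ A} {f : A ⟶ B} {δ : Ext E B D}
    {g' : F ⟶ B} {g : B ⟶ K} {δ' : Ext E K F},
    IsTriangle s f' f δ → IsTriangle s g' g δ' →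
    ∃ (G : C) (d : D ⟶ G) (e : G ⟶ F) (h' : G ⟶ A) (δ'' : Ext E K G),
      d ≫ h' = f' ∧ h' ≫ f = e ≫ g' ∧
      IsTriangle s h' (f ≫ g) δ'' ∧
      IsTriangle s d e (pull E g' δ) ∧
      push E e δ'' = δ' ∧
      push E d δ = pull E g δ''

end Additive

/-! ### Length functions and length categories -/

/-- The set of isomorphism classes of objects. -/
abbrev IsoClasses (C : Type u) [Category.{v} C] := Quotient (isIsomorphicSetoid C)

/-- The value of `Θ` at (the isomorphism class of) an object. -/
def len (Θ : IsoClasses C → ℕ) (X : C) : ℕ := Θ (Quotient.mk (isIsomorphicSetoid C) X)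

/-- `Θ` is a length function on `(C, 𝔼, 𝔰)`. -/
structure IsLengthFunction {E : Cᵒᵖ ⥤ C ⥤ AddCommGrpCat.{w}} (s : Correspondence E)
    (Θ : IsoClasses C → ℕ) : Prop where
  len_eq_zero_iff : ∀ X : C, len Θ X = 0 ↔ IsZero X
  len_le : ∀ {X L M : C} {x : X ⟶ L} {y : L ⟶ M} {δ : Ext E M X},
    IsTriangle s x y δ → len Θ L ≤ len Θ X + len Θ M
  len_eq_of_zero : ∀ {X L M : C} {x : X ⟶ L} {y : L ⟶ M},
    IsTriangle s x y (0 : Ext E M X) → len Θ L = len Θ X + len Θ M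

/-- The `𝔼`-triangle `X ⟶ L ⟶ M ⇢` is `Θ`-stable. -/
def IsStableTriangle {E : Cᵒᵖ ⥤ C ⥤ AddCommGrpCat.{w}} (s : Correspondence E)
    (Θ : IsoClasses C → ℕ) {X L M : C} (x : X ⟶ L) (y : L ⟶ M) (δ : Ext E M X) : Prop :=
  IsTriangle s x y δ ∧ len Θ L = len Θ X + len Θ M

/-- The morphism `x` is a `Θ`-inflation. -/
def IsThetaInflation {E : Cᵒᵖ ⥤ C ⥤ AddCommGrpCat.{w}} (s : Correspondence E)
    (Θ : IsoClasses C → ℕ) {X L : C} (x : X ⟶ L) : Prop :=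
  ∃ (M : C) (y : L ⟶ M) (δ : Ext E M X), IsStableTriangle s Θ x y δ

/-- The morphism `y` is a `Θ`-deflation. -/
def IsThetaDeflation {E : Cᵒᵖ ⥤ C ⥤ AddCommGrpCat.{w}} (s : Correspondence E)
    (Θ : IsoClasses C → ℕ) {L M : C} (y : L ⟶ M) : Prop :=
  ∃ (X : C) (x : X ⟶ L) (δ : Ext E M X), IsStableTriangle s Θ x y δ

/-- The extension `δ` is a `Θ`-extension. -/
def IsThetaExtension {E : Cᵒᵖ ⥤ C ⥤ AddCommGrpCat.{w}} (s : Correspondence E)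
    (Θ : IsoClasses C → ℕ) {M X : C} (δ : Ext E M X) : Prop :=
  ∃ (L : C) (x : X ⟶ L) (y : L ⟶ M), IsStableTriangle s Θ x y δ

/-- The morphism `f` is `Θ`-admissible: it is a `Θ`-deflation followed by a `Θ`-inflation. -/
def IsThetaAdmissible {E : Cᵒᵖ ⥤ C ⥤ AddCommGrpCat.{w}} (s : Correspondence E)
    (Θ : IsoClasses C → ℕ) {M N : C} (f : M ⟶ N) : Prop :=
  ∃ (X : C) (i : M ⟶ X) (j : X ⟶ N),
    IsThetaDeflation s Θ i ∧ IsThetaInflation s Θ j ∧ i ≫ j = f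

/-- `((C, 𝔼, 𝔰), Θ)` is an extriangulated length category. -/
structure IsLengthCategory [Preadditive C] [HasFiniteBiproducts C]
    (E : Cᵒᵖ ⥤ C ⥤ AddCommGrpCat.{w}) (s : Correspondence E) (Θ : IsoClasses C → ℕ) :
    Prop where
  extriangulated : IsExtriangulated E s
  lengthFunction : IsLengthFunction s Θ
  admissible : ∀ {M N : C} (f : M ⟶ N), IsThetaAdmissible s Θ f

/-- `((C, 𝔼, 𝔰), Θ)` is a stable length category: a length category whose length function is
additive on all `𝔼`-triangles. -/
structure IsStableLengthCategory [Preadditive C] [HasFiniteBiproducts C]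
    (E : Cᵒᵖ ⥤ C ⥤ AddCommGrpCat.{w}) (s : Correspondence E) (Θ : IsoClasses C → ℕ) : Prop
    extends IsLengthCategory E s Θ where
  stable : ∀ {X L M : C} {x : X ⟶ L} {y : L ⟶ M} {δ : Ext E M X},
    IsTriangle s x y δ → len Θ L = len Θ X + len Θ M

/-! ### Additive subfunctors and the restricted structure -/

/-- The subsets `F Z X ⊆ 𝔼(Z, X)` form an additive subfunctor of `𝔼`. -/
structure IsAdditiveSubfunctor (E : Cᵒᵖ ⥤ C ⥤ AddCommGrpCat.{w})
    (F : ∀ Z X : C, Set (Ext E Z X)) : Prop where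
  zero_mem : ∀ Z X : C, (0 : Ext E Z X) ∈ F Z X
  add_mem : ∀ {Z X : C} {δ δ' : Ext E Z X}, δ ∈ F Z X → δ' ∈ F Z X → δ + δ' ∈ F Z X
  neg_mem : ∀ {Z X : C} {δ : Ext E Z X}, δ ∈ F Z X → -δ ∈ F Z X
  push_mem : ∀ {Z X X' : C} (a : X ⟶ X') {δ : Ext E Z X}, δ ∈ F Z X → push E a δ ∈ F Z X'
  pull_mem : ∀ {Z Z' X : C} (c : Z' ⟶ Z) {δ : Ext E Z X}, δ ∈ F Z X → pull E c δ ∈ F Z' X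

namespace IsAdditiveSubfunctor

variable {E : Cᵒᵖ ⥤ C ⥤ AddCommGrpCat.{w}} {F : ∀ Z X : C, Set (Ext E Z X)}

/-- The subgroup `F Z X` of `𝔼(Z, X)`. -/
def subgroup (h : IsAdditiveSubfunctor E F) (Z X : C) : AddSubgroup (Ext E Z X) where
  carrier := F Z X
  zero_mem' := h.zero_mem Z X
  add_mem' := h.add_mem
  neg_mem' := h.neg_mem

/-- An additive subfunctor as a bifunctor to abelian groups, with the maps restricted
from `𝔼`. -/
def bifunctor (h : IsAdditiveSubfunctor E F) : Cᵒᵖ ⥤ C ⥤ AddCommGrpCat.{w} where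
  obj Z :=
    { obj := fun X => AddCommGrpCat.of (h.subgroup Z.unop X)
      map := fun {X X'} a => AddCommGrpCat.ofHom
        ((((E.obj Z).map a).hom.comp (h.subgroup Z.unop X).subtype).codRestrict
          (h.subgroup Z.unop X') fun δ => h.push_mem a δ.2)
      map_id := by
        intro X
        ext δ
        change ((E.obj Z).map (𝟙 X)).hom δ.1 = δ.1
        simp
      map_comp := by
        intro X X' X'' a b
        ext δ
        change ((E.obj Z).map (a ≫ b)).hom δ.1 = ((E.obj Z).map b).hom (((E.obj Z).map a).hom δ.1)
        simp }
  map {Z Z'} c :=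
    { app := fun X => AddCommGrpCat.ofHom
        ((((E.map c).app X).hom.comp (h.subgroup Z.unop X).subtype).codRestrict
          (h.subgroup Z'.unop X) fun δ => h.pull_mem c.unop δ.2)
      naturality := by
        intro X X' a
        ext δ
        change ((E.map c).app X').hom (((E.obj Z).map a).hom δ.1) =
          ((E.obj Z').map a).hom (((E.map c).app X).hom δ.1)
        exact congrArg (fun φ => φ.hom δ.1) ((E.map c).naturality a) }
  map_id := by
    intro Z
    ext X δ
    change ((E.map (𝟙 Z)).app X).hom δ.1 = δ.1
    simp
  map_comp := by
    intro Z Z' Z'' c d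
    ext X δ
    change ((E.map (c ≫ d)).app X).hom δ.1 = ((E.map d).app X).hom (((E.map c).app X).hom δ.1)
    simp

/-- The restriction of `𝔰` to an additive subfunctor of `𝔼`. -/
def restrict (h : IsAdditiveSubfunctor E F) (s : Correspondence E) :
    Correspondence h.bifunctor :=
  fun Z X (δ : h.subgroup Z X) => s δ.1

end IsAdditiveSubfunctor

/-- The subset `𝔼_Θ(Z, X)` of `𝔼(Z, X)` of all `Θ`-extensions. -/
def thetaExt {E : Cᵒᵖ ⥤ C ⥤ AddCommGrpCat.{w}} (s : Correspondence E) (Θ : IsoClasses C → ℕ)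
    (Z X : C) : Set (Ext E Z X) :=
  {δ | IsThetaExtension s Θ δ}

/-- Krull–Schmidt categories: every object is a finite direct sum of objects with local
endomorphism rings. -/
def IsKrullSchmidt (C : Type u) [Category.{v} C] [Preadditive C] [HasFiniteBiproducts C] : Prop :=
  ∀ X : C, ∃ (n : ℕ) (Y : Fin n → C),
    (∀ i, IsLocalRing (End (Y i))) ∧ Nonempty (X ≅ ⨁ Y)

end Extri

end

/-! The key is that `Θ`-extensions are stable under push-forward. Let `X ⟶ L ⟶ M` be a `Θ`-stable
triangle with extension `δ`, let `a : X ⟶ X'`, and let `W` be the middle term of the extension of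
`M` by `X' ⊞ X` induced by `δ`. Applying (ET4) to the split triangle `X' ⟶ X' ⊞ X ⟶ X` gives a
triangle `X' ⟶ W ⟶ L` with zero extension; applying it to the graph `X ⟶ X' ⊞ X ⟶ X'` of `-a`
gives a triangle `X ⟶ W ⟶ G`, where `G` is the middle term of the push-forward of `δ` along `a`.
Subadditivity now yields `Θ X' + Θ L = Θ W ≤ Θ X + Θ G`, hence `Θ X' + Θ M ≤ Θ G`. Pull-backs are
dual, and a sum of extensions is obtained from their direct sum by a pull-back and a push-forward.

By a similar count in (ET4), `Θ`-inflations and `Θ`-deflations are closed under composition, and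
an additive subfunctor with this closure property inherits the extriangulated structure. -/

namespace Extri

section Bifunctor

variable {C : Type u} [Category.{v} C] (E : Cᵒᵖ ⥤ C ⥤ AddCommGrpCat.{w})

@[simp]
theorem push_id {Z X : C} (δ : Ext E Z X) : push E (𝟙 X) δ = δ := by
  simp [push]

@[simp]
theorem pull_id {Z X : C} (δ : Ext E Z X) : pull E (𝟙 Z) δ = δ := by
  simp [pull]

theorem push_comp {Z X X' X'' : C} (a : X ⟶ X') (b : X' ⟶ X'') (δ : Ext E Z X) :
    push E (a ≫ b) δ = push E b (push E a δ) := by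
  simp [push]

theorem pull_comp {Z Z' Z'' X : C} (d : Z'' ⟶ Z') (c : Z' ⟶ Z) (δ : Ext E Z X) :
    pull E (d ≫ c) δ = pull E d (pull E c δ) := by
  simp [pull]

theorem push_pull {Z Z' X X' : C} (a : X ⟶ X') (c : Z' ⟶ Z) (δ : Ext E Z X) :
    push E a (pull E c δ) = pull E c (push E a δ) :=
  (congrArg (fun φ ↦ φ.hom δ) ((E.map c.op).naturality a)).symm

theorem push_add_right {Z X X' : C} (a : X ⟶ X') (δ δ' : Ext E Z X) :
    push E a (δ + δ') = push E a δ + push E a δ' :=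
  map_add _ _ _

theorem pull_add_right {Z Z' X : C} (c : Z' ⟶ Z) (δ δ' : Ext E Z X) :
    pull E c (δ + δ') = pull E c δ + pull E c δ' :=
  map_add _ _ _

theorem add_eq_push_pull_extSum [Preadditive C] [HasFiniteBiproducts C] {Z X : C}
    (δ δ' : Ext E Z X) :
    δ + δ' = push E (biprod.desc (𝟙 X) (𝟙 X))
      (pull E (biprod.lift (𝟙 Z) (𝟙 Z)) (extSum E δ δ')) := by
  simp only [extSum, pull_add_right, push_add_right, ← push_pull, ← push_comp, ← pull_comp,
    biprod.inl_desc, biprod.inr_desc, biprod.lift_fst, biprod.lift_snd, push_id, pull_id]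

end Bifunctor

section Triangle

variable {C : Type u} [Category.{v} C] {E : Cᵒᵖ ⥤ C ⥤ AddCommGrpCat.{w}}

theorem exists_isTriangle (s : Correspondence E) {Z X : C} (δ : Ext E Z X) :
    ∃ (Y : C) (x : X ⟶ Y) (y : Y ⟶ Z), IsTriangle s x y δ := by
  obtain ⟨⟨Y, x, y⟩, h⟩ := Quotient.exists_rep (s δ)
  exact ⟨Y, x, y, h.symm⟩

/-- The inflations of a correspondence, that is, the first morphisms of its triangles. They are
used to express when an additive subfunctor inherits an extriangulated structure. -/
def inflations (s : Correspondence E) : MorphismProperty C :=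
  fun X _ x ↦ ∃ (Z : C) (y : _ ⟶ Z) (δ : Ext E Z X), IsTriangle s x y δ

/-- The deflations of a correspondence, that is, the second morphisms of its triangles; dual to
`inflations`. -/
def deflations (s : Correspondence E) : MorphismProperty C :=
  fun _ Z y ↦ ∃ (X : C) (x : X ⟶ _) (δ : Ext E Z X), IsTriangle s x y δ

namespace IsTriangle

variable {s : Correspondence E} {X Y Y' Z : C} {x : X ⟶ Y} {y : Y ⟶ Z} {x' : X ⟶ Y'}
  {y' : Y' ⟶ Z} {δ : Ext E Z X}

theorem comp_iso (t : IsTriangle s x y δ) (e : Y ≅ Y') :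
    IsTriangle s (x ≫ e.hom) (e.inv ≫ y) δ :=
  Eq.trans t (Quotient.sound ⟨e, rfl, by simp⟩)

theorem nonempty_iso (t : IsTriangle s x y δ) (t' : IsTriangle s x' y' δ) : Nonempty (Y ≅ Y') := by
  obtain ⟨e, -, -⟩ := Quotient.exact (t.symm.trans t')
  exact ⟨e⟩

end IsTriangle

end Triangle

namespace IsExtriangulated

variable {C : Type u} [Category.{v} C] [Preadditive C] [HasFiniteBiproducts C]
  {E : Cᵒᵖ ⥤ C ⥤ AddCommGrpCat.{w}} {s : Correspondence E}

theorem push_zero_left (h : IsExtriangulated E s) {Z X X' : C} (δ : Ext E Z X) :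
    push E (0 : X ⟶ X') δ = 0 := by
  simpa using h.push_add 0 0 δ

theorem pull_zero_left (h : IsExtriangulated E s) {Z Z' X : C} (δ : Ext E Z X) :
    pull E (0 : Z' ⟶ Z) δ = 0 := by
  simpa using h.pull_add 0 0 δ

theorem push_neg_left (h : IsExtriangulated E s) {Z X X' : C} (a : X ⟶ X') (δ : Ext E Z X) :
    push E (-a) δ = -push E a δ := by
  rw [eq_neg_iff_add_eq_zero, ← h.push_add, neg_add_cancel, h.push_zero_left]

theorem isTriangle_graph (h : IsExtriangulated E s) {X X' : C} (a : X ⟶ X') :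
    IsTriangle s (biprod.lift a (𝟙 X)) (biprod.desc (𝟙 X') (-a)) (0 : Ext E X' X) := by
  let e : X ⊞ X' ≅ X' ⊞ X :=
    { hom := biprod.desc (biprod.lift a (𝟙 X)) biprod.inl
      inv := biprod.desc biprod.inr (biprod.lift (𝟙 X) (-a))
      hom_inv_id := by ext <;> simp [biprod.lift_desc]
      inv_hom_id := by ext <;> simp [biprod.lift_desc] }
  convert (h.realize_zero X X').comp_iso e using 1
  · simp [e]
  · ext <;> simp [e]

theorem exists_split_of_isTriangle_push_inr (h : IsExtriangulated E s) {X X' W M : C}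
    {δ : Ext E M X} {x : X' ⊞ X ⟶ W} {y : W ⟶ M}
    (t : IsTriangle s x y (push E biprod.inr δ)) :
    ∃ (L : C) (i : X ⟶ L) (p : L ⟶ M) (j : X' ⟶ W) (q : W ⟶ L),
      IsTriangle s i p δ ∧ IsTriangle s j q (0 : Ext E L X') := by
  obtain ⟨L, q, i, p, ε, -, -, tε, tδ, -, hε⟩ := h.et4 (h.realize_zero X' X) t
  rw [← push_comp, biprod.inr_snd, push_id] at tδ
  have ε_eq_zero : ε = 0 := calc
    ε = push E biprod.fst (push E (biprod.inl : X' ⟶ X' ⊞ X) ε) := by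
      rw [← push_comp, biprod.inl_fst, push_id]
    _ = push E ((biprod.inr : X ⟶ X' ⊞ X) ≫ biprod.fst) (pull E p δ) := by
      rw [hε, push_comp, push_pull E biprod.inr]
    _ = 0 := by rw [biprod.inr_fst, h.push_zero_left]
  exact ⟨L, i, p, _, q, tδ, ε_eq_zero ▸ tε⟩

theorem exists_split_of_isTriangle_pull_fst (h : IsExtriangulated E s) {X W M M' : C}
    {δ : Ext E M X} {x : X ⟶ W} {y : W ⟶ M ⊞ M'}
    (t : IsTriangle s x y (pull E biprod.fst δ)) :
    ∃ (L : C) (i : X ⟶ L) (p : L ⟶ M) (j : L ⟶ W) (q : W ⟶ M'),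
      IsTriangle s i p δ ∧ IsTriangle s j q (0 : Ext E M' L) := by
  obtain ⟨L, i, p, j, ε, -, -, tε, tδ, -, hε⟩ := h.et4_op t (h.realize_zero M M')
  rw [← pull_comp, biprod.inl_fst, pull_id] at tδ
  have ε_eq_zero : ε = 0 := calc
    ε = pull E biprod.inr (pull E (biprod.snd : M ⊞ M' ⟶ M') ε) := by
      rw [← pull_comp, biprod.inr_snd, pull_id]
    _ = pull E ((biprod.inr : M' ⟶ M ⊞ M') ≫ biprod.fst) (push E i δ) := by
      rw [← hε, pull_comp, push_pull]
    _ = 0 := by rw [biprod.inr_fst, h.pull_zero_left]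
  exact ⟨L, i, p, j, _, tδ, ε_eq_zero ▸ tε⟩

end IsExtriangulated

namespace IsAdditiveSubfunctor

variable {C : Type u} [Category.{v} C] {E : Cᵒᵖ ⥤ C ⥤ AddCommGrpCat.{w}} {s : Correspondence E}
  {F : ∀ Z X : C, Set (Ext E Z X)} (hF : IsAdditiveSubfunctor E F)
  {X L M : C} {x : X ⟶ L} {y : L ⟶ M} {δ : Ext E M X}

section Extriangulated

variable [Preadditive C] [HasFiniteBiproducts C]

-- By (ET3), `δ` is a pull-back of any other extension whose triangle starts with `x`.
theorem mem_of_inflations_restrict (h : IsExtriangulated E s)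
    (hx : inflations (hF.restrict s) x) (t : IsTriangle s x y δ) : δ ∈ F M X := by
  obtain ⟨M', y', δ', t'⟩ := hx
  obtain ⟨c, -, hc⟩ := h.et3 t t' (𝟙 X) (𝟙 L) (by simp)
  rw [push_id] at hc
  exact hc ▸ hF.pull_mem c δ'.2

theorem mem_of_deflations_restrict (h : IsExtriangulated E s)
    (hy : deflations (hF.restrict s) y) (t : IsTriangle s x y δ) : δ ∈ F M X := by
  obtain ⟨X', x', δ', t'⟩ := hy
  obtain ⟨a, -, ha⟩ := h.et3_op t' t (𝟙 L) (𝟙 M) (by simp)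
  rw [pull_id] at ha
  exact ha ▸ hF.push_mem a δ'.2

theorem isExtriangulated_restrict (h : IsExtriangulated E s)
    [(inflations (hF.restrict s)).IsStableUnderComposition]
    [(deflations (hF.restrict s)).IsStableUnderComposition] :
    IsExtriangulated hF.bifunctor (hF.restrict s) where
  push_add a b δ := Subtype.ext (h.push_add a b δ.1)
  pull_add a b δ := Subtype.ext (h.pull_add a b δ.1)
  realize t t' a c hac := h.realize t t' a c (congrArg Subtype.val hac)
  realize_zero := h.realize_zero
  realize_sum t t' := h.realize_sum t t'
  et3 t t' a b hab := by
    obtain ⟨c, hc, hδ⟩ := h.et3 t t' a b hab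
    exact ⟨c, hc, Subtype.ext hδ⟩
  et3_op t t' b c hbc := by
    obtain ⟨a, ha, hδ⟩ := h.et3_op t t' b c hbc
    exact ⟨a, ha, Subtype.ext hδ⟩
  et4 t t' := by
    obtain ⟨G, h', d, e, δ'', hd, he, t₁, t₂, hδ, hδ'⟩ := h.et4 t t'
    have mem : δ'' ∈ F _ _ := hF.mem_of_inflations_restrict h
      ((inflations (hF.restrict s)).comp_mem _ _ ⟨_, _, _, t⟩ ⟨_, _, _, t'⟩) t₁
    exact ⟨G, h', d, e, ⟨δ'', mem⟩, hd, he, t₁, t₂, Subtype.ext hδ, Subtype.ext hδ'⟩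
  et4_op t t' := by
    obtain ⟨G, d, e, h', δ'', hd, he, t₁, t₂, hδ, hδ'⟩ := h.et4_op t t'
    have mem : δ'' ∈ F _ _ := hF.mem_of_deflations_restrict h
      ((deflations (hF.restrict s)).comp_mem _ _ ⟨_, _, _, t⟩ ⟨_, _, _, t'⟩) t₁
    exact ⟨G, d, e, h', ⟨δ'', mem⟩, hd, he, t₁, t₂, Subtype.ext hδ, Subtype.ext hδ'⟩

end Extriangulated

variable {Θ : IsoClasses C → ℕ}

theorem isLengthFunction_restrict (hΘ : IsLengthFunction s Θ) :
    IsLengthFunction (hF.restrict s) Θ where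
  len_eq_zero_iff := hΘ.len_eq_zero_iff
  len_le t := hΘ.len_le t
  len_eq_of_zero t := hΘ.len_eq_of_zero t

theorem isThetaAdmissible_restrict (hF' : ∀ Z X : C, thetaExt s Θ Z X ⊆ F Z X) {f : L ⟶ M}
    (hf : IsThetaAdmissible s Θ f) : IsThetaAdmissible (hF.restrict s) Θ f := by
  obtain ⟨X, i, j, ⟨K, k, δ, t⟩, ⟨Q, q, δ', t'⟩, hij⟩ := hf
  have hi : IsThetaDeflation (hF.restrict s) Θ i := ⟨K, k, ⟨δ, hF' _ _ ⟨_, _, _, t⟩⟩, t⟩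
  have hj : IsThetaInflation (hF.restrict s) Θ j := ⟨Q, q, ⟨δ', hF' _ _ ⟨_, _, _, t'⟩⟩, t'⟩
  exact ⟨X, i, j, hi, hj, hij⟩

end IsAdditiveSubfunctor

section ThetaExtension

variable {C : Type u} [Category.{v} C] {E : Cᵒᵖ ⥤ C ⥤ AddCommGrpCat.{w}} {s : Correspondence E}
  {Θ : IsoClasses C → ℕ}

theorem len_congr (Θ : IsoClasses C → ℕ) {X Y : C} (e : X ≅ Y) : len Θ X = len Θ Y :=
  congrArg Θ (Quotient.sound ⟨e⟩)

theorem IsThetaExtension.len_eq {X L M : C} {x : X ⟶ L} {y : L ⟶ M} {δ : Ext E M X}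
    (hδ : IsThetaExtension s Θ δ) (t : IsTriangle s x y δ) : len Θ L = len Θ X + len Θ M := by
  obtain ⟨L', x', y', t', hL'⟩ := hδ
  obtain ⟨e⟩ := t.nonempty_iso t'
  exact (len_congr Θ e).trans hL'

theorem inflations_restrict_thetaExt_iff (hF : IsAdditiveSubfunctor E (thetaExt s Θ)) {X L : C}
    {x : X ⟶ L} : inflations (hF.restrict s) x ↔ IsThetaInflation s Θ x :=
  ⟨fun ⟨M, y, δ, t⟩ ↦ ⟨M, y, δ.1, t, IsThetaExtension.len_eq δ.2 t⟩,
    fun ⟨M, y, δ, t⟩ ↦ ⟨M, y, ⟨δ, _, _, _, t⟩, t.1⟩⟩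

theorem deflations_restrict_thetaExt_iff (hF : IsAdditiveSubfunctor E (thetaExt s Θ)) {L M : C}
    {y : L ⟶ M} : deflations (hF.restrict s) y ↔ IsThetaDeflation s Θ y :=
  ⟨fun ⟨X, x, δ, t⟩ ↦ ⟨X, x, δ.1, t, IsThetaExtension.len_eq δ.2 t⟩,
    fun ⟨X, x, δ, t⟩ ↦ ⟨X, x, ⟨δ, _, _, _, t⟩, t.1⟩⟩

variable [Preadditive C] [HasFiniteBiproducts C]

theorem len_biprod (h : IsExtriangulated E s) (hΘ : IsLengthFunction s Θ) (X Y : C) :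
    len Θ (X ⊞ Y) = len Θ X + len Θ Y :=
  hΘ.len_eq_of_zero (h.realize_zero X Y)

namespace IsThetaExtension

theorem zero (h : IsExtriangulated E s) (hΘ : IsLengthFunction s Θ) (Z X : C) :
    IsThetaExtension s Θ (0 : Ext E Z X) :=
  ⟨_, _, _, h.realize_zero X Z, len_biprod h hΘ X Z⟩

theorem extSum (h : IsExtriangulated E s) (hΘ : IsLengthFunction s Θ) {X X' Z Z' : C}
    {δ : Ext E Z X} {δ' : Ext E Z' X'} (hδ : IsThetaExtension s Θ δ)
    (hδ' : IsThetaExtension s Θ δ') : IsThetaExtension s Θ (extSum E δ δ') := by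
  obtain ⟨L, x, y, t, hL⟩ := hδ
  obtain ⟨L', x', y', t', hL'⟩ := hδ'
  refine ⟨_, _, _, h.realize_sum t t', ?_⟩
  simp only [len_biprod h hΘ, hL, hL']
  ring

theorem push (h : IsExtriangulated E s) (hΘ : IsLengthFunction s Θ) {X X' M : C} (a : X ⟶ X')
    {δ : Ext E M X} (hδ : IsThetaExtension s Θ δ) : IsThetaExtension s Θ (push E a δ) := by
  obtain ⟨W, x, y, tW⟩ := exists_isTriangle s (Extri.push E (biprod.inr : X ⟶ X' ⊞ X) δ)
  obtain ⟨L, i, p, j, q, tL, tsplit⟩ := h.exists_split_of_isTriangle_push_inr tW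
  obtain ⟨G, r, d, e, ε, -, -, tε, tG, -, -⟩ := h.et4 (h.isTriangle_graph (-a)) tW
  rw [← push_comp, biprod.inr_desc, neg_neg] at tG
  have hL : len Θ L = len Θ X + len Θ M := hδ.len_eq tL
  have hW : len Θ W = len Θ X' + len Θ L := hΘ.len_eq_of_zero tsplit
  have hWG : len Θ W ≤ len Θ X + len Θ G := hΘ.len_le tε
  have hG : len Θ G ≤ len Θ X' + len Θ M := hΘ.len_le tG
  exact ⟨G, d, e, tG, by omega⟩

theorem pull (h : IsExtriangulated E s) (hΘ : IsLengthFunction s Θ) {X M M' : C} (c : M' ⟶ M)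
    {δ : Ext E M X} (hδ : IsThetaExtension s Θ δ) : IsThetaExtension s Θ (pull E c δ) := by
  obtain ⟨W, x, y, tW⟩ := exists_isTriangle s (Extri.pull E (biprod.fst : M ⊞ M' ⟶ M) δ)
  obtain ⟨L, i, p, j, q, tL, tsplit⟩ := h.exists_split_of_isTriangle_pull_fst tW
  obtain ⟨G, d, e, r, ε, -, -, tε, tG, -, -⟩ := h.et4_op tW (h.isTriangle_graph c)
  rw [← pull_comp, biprod.lift_fst] at tG
  have hL : len Θ L = len Θ X + len Θ M := hδ.len_eq tL
  have hW : len Θ W = len Θ L + len Θ M' := hΘ.len_eq_of_zero tsplit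
  have hWG : len Θ W ≤ len Θ G + len Θ M := hΘ.len_le tε
  have hG : len Θ G ≤ len Θ X + len Θ M' := hΘ.len_le tG
  exact ⟨G, d, e, tG, by omega⟩

theorem neg (h : IsExtriangulated E s) (hΘ : IsLengthFunction s Θ) {X Z : C} {δ : Ext E Z X}
    (hδ : IsThetaExtension s Θ δ) : IsThetaExtension s Θ (-δ) := by
  simpa only [h.push_neg_left, push_id] using hδ.push h hΘ (-𝟙 X)

theorem add (h : IsExtriangulated E s) (hΘ : IsLengthFunction s Θ) {X Z : C}
    {δ δ' : Ext E Z X} (hδ : IsThetaExtension s Θ δ) (hδ' : IsThetaExtension s Θ δ') :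
    IsThetaExtension s Θ (δ + δ') :=
  add_eq_push_pull_extSum E δ δ' ▸ ((hδ.extSum h hΘ hδ').pull h hΘ _).push h hΘ _

end IsThetaExtension

theorem isAdditiveSubfunctor_thetaExt (h : IsExtriangulated E s) (hΘ : IsLengthFunction s Θ) :
    IsAdditiveSubfunctor E (thetaExt s Θ) where
  zero_mem := IsThetaExtension.zero h hΘ
  add_mem hδ hδ' := hδ.add h hΘ hδ'
  neg_mem hδ := hδ.neg h hΘ
  push_mem a _ hδ := hδ.push h hΘ a
  pull_mem c _ hδ := hδ.pull h hΘ c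

theorem IsThetaInflation.comp (h : IsExtriangulated E s) (hΘ : IsLengthFunction s Θ)
    {A B K : C} {f : A ⟶ B} {g : B ⟶ K} (hf : IsThetaInflation s Θ f)
    (hg : IsThetaInflation s Θ g) : IsThetaInflation s Θ (f ≫ g) := by
  obtain ⟨D, f', δ, tf, hB⟩ := hf
  obtain ⟨F, g', δ', tg, hK⟩ := hg
  obtain ⟨G, p, d, e, δ'', -, -, tfg, tG, -, -⟩ := h.et4 tf tg
  have hG : len Θ G = len Θ D + len Θ F :=
    IsThetaExtension.len_eq (.push h hΘ f' ⟨_, _, _, tg, hK⟩) tG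
  exact ⟨G, p, δ'', tfg, by omega⟩

theorem IsThetaDeflation.comp (h : IsExtriangulated E s) (hΘ : IsLengthFunction s Θ)
    {A B K : C} {f : A ⟶ B} {g : B ⟶ K} (hf : IsThetaDeflation s Θ f)
    (hg : IsThetaDeflation s Θ g) : IsThetaDeflation s Θ (f ≫ g) := by
  obtain ⟨D, f', δ, tf, hA⟩ := hf
  obtain ⟨F, g', δ', tg, hB⟩ := hg
  obtain ⟨G, d, e, i, δ'', -, -, tfg, tG, -, -⟩ := h.et4_op tf tg
  have hG : len Θ G = len Θ D + len Θ F :=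
    IsThetaExtension.len_eq (.pull h hΘ g' ⟨_, _, _, tf, hA⟩) tG
  exact ⟨G, i, δ'', tfg, by omega⟩

theorem isExtriangulated_restrict_thetaExt (hF : IsAdditiveSubfunctor E (thetaExt s Θ))
    (h : IsExtriangulated E s) (hΘ : IsLengthFunction s Θ) :
    IsExtriangulated hF.bifunctor (hF.restrict s) := by
  have : (inflations (hF.restrict s)).IsStableUnderComposition :=
    ⟨fun f g ↦ by simpa only [inflations_restrict_thetaExt_iff] using IsThetaInflation.comp h hΘ⟩
  have : (deflations (hF.restrict s)).IsStableUnderComposition :=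
    ⟨fun f g ↦ by simpa only [deflations_restrict_thetaExt_iff] using IsThetaDeflation.comp h hΘ⟩
  exact hF.isExtriangulated_restrict h

end ThetaExtension

end Extri

theorem proposition3_general {C : Type u} [Category.{v} C] [Preadditive C] [HasFiniteBiproducts C]
    (E : Cᵒᵖ ⥤ C ⥤ AddCommGrpCat.{w}) (s : Extri.Correspondence E)
    (Θ : Extri.IsoClasses C → ℕ) (hΘ : Extri.IsLengthCategory E s Θ) :
    ∃ h : Extri.IsAdditiveSubfunctor E (Extri.thetaExt s Θ),
      Extri.IsStableLengthCategory h.bifunctor (h.restrict s) Θ := by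
  have hF := Extri.isAdditiveSubfunctor_thetaExt hΘ.extriangulated hΘ.lengthFunction
  exact ⟨hF,
    { extriangulated :=
        Extri.isExtriangulated_restrict_thetaExt hF hΘ.extriangulated hΘ.lengthFunction
      lengthFunction := hF.isLengthFunction_restrict hΘ.lengthFunction
      admissible f := hF.isThetaAdmissible_restrict (fun _ _ ↦ subset_rfl) (hΘ.admissible f)
      stable {_ _ _ _ _ δ} t := Extri.IsThetaExtension.len_eq (s := s) δ.2 t }⟩

theorem proposition3 {C : Type u} [Category.{v} C] [Preadditive C] [HasFiniteBiproducts C]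
    (hKS : Extri.IsKrullSchmidt C)
    (E : Cᵒᵖ ⥤ C ⥤ AddCommGrpCat.{w}) (s : Extri.Correspondence E)
    (Θ : Extri.IsoClasses C → ℕ) (hΘ : Extri.IsLengthCategory E s Θ) :
    ∃ h : Extri.IsAdditiveSubfunctor E (Extri.thetaExt s Θ),
      Extri.IsStableLengthCategory h.bifunctor (h.restrict s) Θ :=
  proposition3_general E s Θ hΘ
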